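/- Let $X=\{1,2,3\}$ and let $X^*$ be the infinite rooted ternary tree: its vertices are the finite words over $X$, its root is the empty word, the level of a vertex is its length, and each word $u$ is joined to $u1,u2,u3$. Let $\mathrm{Aut}(X^*)$ be the group of bijections of the vertex set which fix the root and preserve edge incidences. Let $a$ (respectively $b$, $c$) be the automorphism which, in a word, looks for the first letter in $\{2,3\}$ (respectively $\{1,3\}$, $\{1,2\}$), if there is one, and replaces it by the other element of that set. In wreath notation, $a=(a,1,1)\sigma_{23}$, $b=(1,b,1)\sigma_{13}$, $c=(1,1,c)\sigma_{12}$. The Hanoi towers group is $\Gamma=\langle a,b,c\rangle\le \mathrm{Aut}(X^*)$. For $n\ge 0$ let $\mathrm{Stab}_\Gamma(n)$ be the normal subgroup of the elements of $\Gamma$ which fix every vertex of level $n$. For a vertex $u$ let $\mathrm{Rist}_\Gamma(u)$ be the subgroup of the elements of $\Gamma$ which fix every vertex that is not a descendant of $u$ (that is, does not have $u$ as a prefix), and let $\mathrm{Rist}_\Gamma(n)=\langle \mathrm{Rist}_\Gamma(u) : |u|=n\rangle$, a normal subgroup of $\Gamma$ contained in $\mathrm{Stab}_\Gamma(n)$.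 Let $$\overline{\Gamma}=\varprojlim_{n\ge1}\Gamma/\mathrm{Stab}_\Gamma(n),\qquad \widetilde{\Gamma}=\varprojlim_{n\ge1}\Gamma/\mathrm{Rist}_\Gamma(n)$$ be the congruence completion and the branch completion of $\Gamma$. The rigid kernel of $\Gamma$ is the kernel of the natural map $\widetilde{\Gamma}\to\overline{\Gamma}$. For $n\ge 1$ let $\Gamma_n=\mathrm{Stab}_\Gamma(n)/\mathrm{Rist}_\Gamma(n)$, and for $k\ge 0$ let $\rho_{n,n+k}:\Gamma_{n+k}\to\Gamma_n$ be the map induced by the inclusion of $\mathrm{Stab}_\Gamma(n+k)$ in $\mathrm{Stab}_\Gamma(n)$. **Theorem.** 1. The rigid kernel $\ker(\widetilde{\Gamma}\to\overline{\Gamma})$ of the Hanoi towers group is isomorphic to the Klein four-group. 2. The rigid kernel is the inverse limit $\varprojlim_{n\ge1}\Gamma_n$ (with respect to the maps $\rho_{n,n+k}$): the natural map $\varprojlim_{n\ge1}\Gamma_n\to\widetilde{\Gamma}$ is injective, and its image is the rigid kernel. 3. $|\Gamma_n|=2^{2(3^{n-1}+1)}$ for all $n\ge 1$. 4. For all $n,k\ge1$,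 the image of $\rho_{n,n+k}$ has order $4$ and equals the image of $\rho_{n,n+1}$. -/

import Mathlib

namespace HanoiTowers

/-- Vertices of the infinite rooted ternary tree: finite words over `{0, 1, 2}` (the letters
`1, 2, 3` shifted by one). The root is `[]`, the level of a vertex is its length. -/
abbrev Vertex : Type := List (Fin 3)

/-- The infinite rooted ternary tree: each vertex `u` is joined to its three children
`u ++ [x]`. -/
def ternaryTree : SimpleGraph Vertex where
  Adj u v := (∃ x, v = u ++ [x]) ∨ (∃ x, u = v ++ [x])
  symm := ⟨fun _ _ h => h.symm⟩
  loopless := ⟨fun u h => by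
    rcases h with ⟨x, h⟩ | ⟨x, h⟩ <;> simpa using congrArg List.length h⟩

/-- The automorphism group of the rooted ternary tree: the bijections of the vertex set that
fix the root and preserve edge incidences. -/
def treeAut : Subgroup (Equiv.Perm Vertex) where
  carrier := {g | g [] = [] ∧ ∀ u v, ternaryTree.Adj (g u) (g v) ↔ ternaryTree.Adj u v}
  one_mem' := ⟨rfl, fun _ _ => Iff.rfl⟩
  mul_mem' := fun {g h} hg hh =>
    ⟨by simp [hh.1, hg.1], fun u v => (hg.2 (h u) (h v)).trans (hh.2 u v)⟩
  inv_mem' := fun {g} hg =>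
    ⟨by rw [Equiv.Perm.inv_eq_iff_eq]; exact hg.1.symm,
      fun u v => by simpa using (hg.2 (g⁻¹ u) (g⁻¹ v)).symm⟩

/-! ### Elementary facts on tree automorphisms -/

theorem treeAut_child (g : treeAut) (u : Vertex) (x : Fin 3) :
    ∃ y, g.1 (u ++ [x]) = g.1 u ++ [y] := by
  induction u using List.reverseRecOn generalizing x with
  | nil =>
    rcases (g.2.2 [] ([] ++ [x])).2 (Or.inl ⟨x, rfl⟩) with h | ⟨y, h⟩
    · exact h
    · rw [g.2.1] at h
      simpa using congrArg List.length h
  | append_singleton u z ih =>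
    rcases (g.2.2 (u ++ [z]) (u ++ [z] ++ [x])).2 (Or.inl ⟨x, rfl⟩) with h | ⟨y, h⟩
    · exact h
    · obtain ⟨w, hw⟩ := ih z
      rw [hw] at h
      have h1 := g.1.injective (List.append_inj_left' h rfl)
      have h2 := congrArg List.length h1
      simp at h2

theorem treeAut_length (g : treeAut) (u : Vertex) : (g.1 u).length = u.length := by
  induction u using List.reverseRecOn with
  | nil => rw [g.2.1]
  | append_singleton u x ih =>
    obtain ⟨y, hy⟩ := treeAut_child g u x
    simp [hy, ih]

theorem treeAut_prefix (g : treeAut) {u v : Vertex} (h : u <+: v) : g.1 u <+: g.1 v := by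
  obtain ⟨t, rfl⟩ := h
  induction t using List.reverseRecOn with
  | nil => simp
  | append_singleton t x ih =>
    rw [← List.append_assoc]
    obtain ⟨y, hy⟩ := treeAut_child g (u ++ t) x
    rw [hy]
    exact ih.trans (List.prefix_append _ _)

/-! ### The Hanoi towers group -/

/-- The transformation of the tree which sends a word to the word obtained by looking for the
first letter different from `i` and applying to it the transposition of the two letters different
from `i`. In wreath recursion, it is `(1, …, itself, …, 1) σ` with itself in coordinate `i` and
with `σ` the transposition of the other two letters. -/
def moveFun (i : Fin 3) : Vertex → Vertex
  | [] => []
  | x :: w => Equiv.swap (i + 1) (i + 2) x :: (if x = i then moveFun i w else w)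

theorem moveFun_involutive (i : Fin 3) : Function.Involutive (moveFun i) := by
  intro u
  induction u with
  | nil => rfl
  | cons x w ih =>
    have hi : Equiv.swap (i + 1) (i + 2) x = i ↔ x = i := by
      clear ih; revert i x; decide
    by_cases h : x = i
    · subst h
      have e : Equiv.swap (x + 1) (x + 2) x = x := hi.2 rfl
      simp [moveFun, e, ih]
    · simp [moveFun, hi, h]

theorem moveFun_child (i : Fin 3) (u : Vertex) (x : Fin 3) :
    ∃ y, moveFun i (u ++ [x]) = moveFun i u ++ [y] := by
  induction u with
  | nil => exact ⟨Equiv.swap (i + 1) (i + 2) x, by simp [moveFun]⟩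
  | cons z w ih =>
    obtain ⟨y, hy⟩ := ih
    by_cases h : z = i
    · exact ⟨y, by simp [moveFun, h, hy]⟩
    · exact ⟨x, by simp [moveFun, h]⟩

theorem moveFun_adj (i : Fin 3) {u v : Vertex} (h : ternaryTree.Adj u v) :
    ternaryTree.Adj (moveFun i u) (moveFun i v) := by
  rcases h with ⟨x, rfl⟩ | ⟨x, rfl⟩
  · exact Or.inl (moveFun_child i u x)
  · exact Or.inr (moveFun_child i v x)

/-- The automorphism of the ternary tree given by `moveFun i`. -/
def move (i : Fin 3) : treeAut :=
  ⟨(moveFun_involutive i).toPerm, rfl, fun u v =>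
    ⟨fun h => by
      have := moveFun_adj i h
      simpa [moveFun_involutive i u, moveFun_involutive i v] using this,
    fun h => moveFun_adj i h⟩⟩

/-- `a = (a, 1, 1) σ₂₃`. -/
def a : treeAut := move 0

/-- `b = (1, b, 1) σ₁₃`. -/
def b : treeAut := move 1

/-- `c = (1, 1, c) σ₁₂`. -/
def c : treeAut := move 2

/-- The Hanoi towers group `Γ = ⟨a, b, c⟩`. -/
def hanoiGroup : Subgroup treeAut := Subgroup.closure {a, b, c}

/-! ### Level stabilizers and rigid stabilizers -/

section Stabilizers

variable (G : Subgroup treeAut)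

/-- The stabilizer in `G` of the vertex `u`. -/
def vertexStab (u : Vertex) : Subgroup G where
  carrier := {g | g.1.1 u = u}
  one_mem' := rfl
  mul_mem' := fun {g h} (hg : g.1.1 u = u) (hh : h.1.1 u = u) => by
    change g.1.1 (h.1.1 u) = u
    rw [hh, hg]
  inv_mem' := fun {g} (hg : g.1.1 u = u) => by
    change (g.1.1)⁻¹ u = u
    rw [Equiv.Perm.inv_eq_iff_eq]
    exact hg.symm

/-- The `n`-th level stabilizer of `G`. -/
def levelStab (n : ℕ) : Subgroup G := ⨅ u : {u : Vertex // u.length = n}, vertexStab G u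

/-- The rigid stabilizer in `G` of the vertex `u`: the elements which act trivially outside of
the subtree of descendants of `u`. -/
def vertexRist (u : Vertex) : Subgroup G where
  carrier := {g | ∀ v, ¬ u <+: v → g.1.1 v = v}
  one_mem' := fun _ _ => rfl
  mul_mem' := fun {g h} hg hh v hv => by
    change g.1.1 (h.1.1 v) = v
    rw [hh v hv, hg v hv]
  inv_mem' := fun {g} hg v hv => by
    change (g.1.1)⁻¹ v = v
    rw [Equiv.Perm.inv_eq_iff_eq]
    exact (hg v hv).symm

/-- The `n`-th level rigid stabilizer of `G`: the subgroup generated by the rigid stabilizers of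
the vertices of level `n`. -/
def levelRist (n : ℕ) : Subgroup G := ⨆ u : {u : Vertex // u.length = n}, vertexRist G u

theorem mem_levelStab {n : ℕ} {g : G} :
    g ∈ levelStab G n ↔ ∀ u : Vertex, u.length = n → g.1.1 u = u := by
  simp only [levelStab, Subgroup.mem_iInf, Subtype.forall]
  rfl

instance levelStab_normal (n : ℕ) : (levelStab G n).Normal where
  conj_mem g hg h := by
    rw [mem_levelStab] at hg ⊢
    intro u hu
    change h.1.1 (g.1.1 ((h⁻¹).1.1 u)) = u
    rw [hg _ ((treeAut_length _ u).trans hu)]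
    change h.1.1 ((h.1.1)⁻¹ u) = u
    simp

theorem vertexRist_conj {u : Vertex} {g : G} (hg : g ∈ vertexRist G u) (h : G) :
    h * g * h⁻¹ ∈ vertexRist G (h.1.1 u) := by
  intro v hv
  have e : h.1.1 ((h⁻¹).1.1 v) = v := by
    change h.1.1 ((h.1.1)⁻¹ v) = v
    simp
  change h.1.1 (g.1.1 ((h⁻¹).1.1 v)) = v
  rw [hg _ ?_, e]
  intro hp
  have := treeAut_prefix h.1 hp
  rw [e] at this
  exact hv this

instance levelRist_normal (n : ℕ) : (levelRist G n).Normal where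
  conj_mem g hg h := by
    have key : levelRist G n ≤ (levelRist G n).comap (MulAut.conj h).toMonoidHom := by
      refine iSup_le fun u g hg => ?_
      have hu : (h.1.1 u.1).length = n := (treeAut_length h.1 u.1).trans u.2
      exact le_iSup (fun u : {u : Vertex // u.length = n} => vertexRist G u)
        ⟨h.1.1 u.1, hu⟩ (vertexRist_conj G hg h)
    exact key hg

theorem levelRist_le_levelStab (n : ℕ) : levelRist G n ≤ levelStab G n := by
  refine iSup_le fun u g hg => ?_
  rw [mem_levelStab]
  have aux : ∀ v : Vertex, v.length = n → v ≠ u.1 → g.1.1 v = v := fun v hv hne =>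
    hg v fun hp => hne (hp.eq_of_length (u.2.trans hv.symm)).symm
  intro v hv
  by_contra hne
  have h1 := aux _ ((treeAut_length g.1 v).trans hv)
  by_cases hvu : v = u.1
  · exact hne (g.1.1.injective (h1 (hvu ▸ hne)))
  · exact hne (aux v hv hvu)

theorem levelStab_antitone : Antitone (levelStab G) := by
  refine antitone_nat_of_succ_le fun n g hg => ?_
  rw [mem_levelStab] at hg ⊢
  intro u hu
  obtain ⟨y, hy⟩ := treeAut_child g.1 u 0
  rw [hg (u ++ [0]) (by simp [hu])] at hy
  exact (List.append_inj_left' hy rfl).symm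

theorem levelRist_antitone : Antitone (levelRist G) := by
  intro m n hmn
  refine iSup_le fun u => ?_
  refine le_trans ?_ (le_iSup (fun u : {u : Vertex // u.length = m} => vertexRist G u)
    ⟨u.1.take m, by simp [u.2, hmn]⟩)
  intro g hg v hv
  exact hg v fun hp => hv ((List.take_prefix m u.1).trans hp)

end Stabilizers

/-! ### Completions -/

/-- The natural projection `H ⧸ M → H ⧸ N` for normal subgroups `M ≤ N`. -/
def proj {H : Type*} [Group H] {M N : Subgroup H} [M.Normal] [N.Normal] (h : M ≤ N) :
    H ⧸ M →* H ⧸ N :=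
  QuotientGroup.map M N (MonoidHom.id H) fun _ hx => h hx

/-- The inverse limit, over `n ≥ 1`, of the quotients of `H` by the members of a decreasing
sequence of normal subgroups: the subgroup of the product which consists of the sequences
compatible with the natural projections `H ⧸ N n → H ⧸ N m`, `m ≤ n`. -/
def quotientLimit {H : Type*} [Group H] (N : ℕ → Subgroup H) [∀ n, (N n).Normal]
    (hN : Antitone N) : Subgroup (∀ n : ℕ+, H ⧸ N n) where
  carrier := {x | ∀ m n : ℕ+, ∀ h : m ≤ n, proj (hN (show (m : ℕ) ≤ n from h)) (x n) = x m}
  one_mem' := fun _ _ _ => map_one _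
  mul_mem' := fun {x y} hx hy m n h => by
    rw [Pi.mul_apply, map_mul, hx m n h, hy m n h, Pi.mul_apply]
  inv_mem' := fun {x} hx m n h => by
    rw [Pi.inv_apply, map_inv, hx m n h, Pi.inv_apply]

section Completions

variable (G : Subgroup treeAut)

/-- The congruence completion: the inverse limit of the `G ⧸ Stab_G(n)`, `n ≥ 1`. -/
abbrev congruenceCompletion : Subgroup (∀ n : ℕ+, G ⧸ levelStab G n) :=
  quotientLimit (levelStab G) (levelStab_antitone G)

/-- The branch completion: the inverse limit of the `G ⧸ Rist_G(n)`, `n ≥ 1`. -/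
abbrev branchCompletion : Subgroup (∀ n : ℕ+, G ⧸ levelRist G n) :=
  quotientLimit (levelRist G) (levelRist_antitone G)

/-- The natural projection `G ⧸ Rist_G(n) → G ⧸ Stab_G(n)`. -/
def ristToStab (n : ℕ) : G ⧸ levelRist G n →* G ⧸ levelStab G n :=
  proj (levelRist_le_levelStab G n)

/-- The natural map from the branch completion to the congruence completion. -/
def branchToCongruence : branchCompletion G →* congruenceCompletion G where
  toFun x := ⟨fun n => ristToStab G n (x.1 n), fun m n h => by
    have hx := x.2 m n h
    obtain ⟨g, hg⟩ := QuotientGroup.mk_surjective (x.1 n)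
    rw [← hg] at hx
    beta_reduce
    rw [← hx, ← hg]
    rfl⟩
  map_one' := Subtype.ext (funext fun _ => map_one _)
  map_mul' _ _ := Subtype.ext (funext fun _ => map_mul _ _ _)

/-- The rigid kernel of `G`. -/
def rigidKernel : Subgroup (branchCompletion G) := (branchToCongruence G).ker

/-- The quotient `Stab_G(n) ⧸ Rist_G(n)`. -/
abbrev StabModRist (n : ℕ) : Type :=
  levelStab G n ⧸ (levelRist G n).subgroupOf (levelStab G n)

/-- The map `Stab_G(n) ⧸ Rist_G(n) → Stab_G(m) ⧸ Rist_G(m)`, for `m ≤ n`, induced by the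
inclusion of `Stab_G(n)` in `Stab_G(m)`. -/
def transition {m n : ℕ} (h : m ≤ n) : StabModRist G n →* StabModRist G m :=
  QuotientGroup.map _ _ (Subgroup.inclusion (levelStab_antitone G h))
    fun _ hx => levelRist_antitone G h hx

/-- The inverse limit, over `n ≥ 1`, of the groups `Stab_G(n) ⧸ Rist_G(n)`. -/
def stabModRistLimit : Subgroup (∀ n : ℕ+, StabModRist G n) where
  carrier := {x | ∀ m n : ℕ+, ∀ h : m ≤ n, transition G (m := m) (n := n) h (x n) = x m}
  one_mem' := fun _ _ _ => map_one _
  mul_mem' := fun {x y} hx hy m n h => by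
    rw [Pi.mul_apply, map_mul, hx m n h, hy m n h, Pi.mul_apply]
  inv_mem' := fun {x} hx m n h => by
    rw [Pi.inv_apply, map_inv, hx m n h, Pi.inv_apply]

/-- The natural map `Stab_G(n) ⧸ Rist_G(n) → G ⧸ Rist_G(n)`. -/
def stabModRistToQuotient (n : ℕ) : StabModRist G n →* G ⧸ levelRist G n :=
  QuotientGroup.map _ _ (levelStab G n).subtype fun _ hx => hx

/-- The natural map from the inverse limit of the `Stab_G(n) ⧸ Rist_G(n)` to the branch
completion. -/
def stabModRistLimitToBranch : stabModRistLimit G →* branchCompletion G where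
  toFun x := ⟨fun n => stabModRistToQuotient G n (x.1 n), fun m n h => by
    have hx := x.2 m n h
    obtain ⟨g, hg⟩ := QuotientGroup.mk_surjective (x.1 n)
    rw [← hg] at hx
    beta_reduce
    rw [← hx, ← hg]
    rfl⟩
  map_one' := Subtype.ext (funext fun _ => map_one _)
  map_mul' _ _ := Subtype.ext (funext fun _ => map_mul _ _ _)

end Completions

end HanoiTowers

namespace HanoiTowers

/-! ### Words in the generators -/

/-! Counting the generators modulo 2 gives a well-defined class `cls : Γ → (ℤ/2)³`. The theorem is
linear algebra over `ℤ/2` on the classes of sections.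

The key is `joinH_mem_iff`: a triple `(g₀, g₁, g₂)` of elements of `Γ` lies in `Γ` iff the matrix of
classes `m j x` has the form `α j + β x` and total sum zero. Necessity is a computation along words.
For sufficiency, `Γ` contains every triple of elements of class zero, and four explicit words
realize all 16 admissible matrices.

An admissible matrix with at most one nonzero row vanishes. Hence for `n ≥ 1`, `Rist(n)` consists of
the elements of `Stab(n)` whose sections at level `n` all have class zero (`levelRist_succ_eq`).

Elements of `Stab(1)` have classes in the Klein four-group `V` of vectors of sum zero, and a matrix
with rows in `V` is admissible iff its rows are equal. So the level `n` sections of an element of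
`Stab(n+1)` all have the class of the element itself. Thus `cls` maps each `Γ_n` onto `V`, and its
kernel is exactly the kernel of every map from `Γ_n` to a lower `Γ_m`, `m ≥ 1`: the images and the
limit are copies of `V`. Moreover `|Γ_1| = 16`, and `Γ_{n+1}` is the triple fibre product of `Γ_n`
over `V`, so `|Γ_{n+1}| = |Γ_n|³ / 16`. -/

theorem treeAut_ext {g h : treeAut} (H : ∀ v, g.1 v = h.1 v) : g = h :=
  Subtype.ext (Equiv.ext H)

theorem treeAut_mul_apply (g h : treeAut) (v : Vertex) : (g * h).1 v = g.1 (h.1 v) := rfl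

theorem move_cons (i x : Fin 3) (w : Vertex) :
    (move i).1 (x :: w) = Equiv.swap (i + 1) (i + 2) x :: (if x = i then (move i).1 w else w) := rfl

theorem move_mul_self (i : Fin 3) : move i * move i = 1 :=
  treeAut_ext (moveFun_involutive i)

theorem move_inv (i : Fin 3) : (move i)⁻¹ = move i :=
  inv_eq_of_mul_eq_one_left (move_mul_self i)

/-- The automorphism represented by a word in the generators. -/
def act (w : List (Fin 3)) : treeAut := (w.map move).prod

@[simp] theorem act_nil : act [] = 1 := rfl

@[simp] theorem act_cons (i : Fin 3) (w : List (Fin 3)) : act (i :: w) = move i * act w :=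
  List.prod_cons

theorem act_append (v w : List (Fin 3)) : act (v ++ w) = act v * act w := by
  simp [act]

theorem act_reverse (w : List (Fin 3)) : act w.reverse = (act w)⁻¹ := by
  induction w with
  | nil => simp
  | cons i w ih => simp [act_append, ih, move_inv]

theorem move_mem (i : Fin 3) : move i ∈ hanoiGroup := by
  apply Subgroup.subset_closure
  fin_cases i
  · exact Or.inl rfl
  · exact Or.inr (Or.inl rfl)
  · exact Or.inr (Or.inr rfl)

theorem act_mem (w : List (Fin 3)) : act w ∈ hanoiGroup := by
  induction w with
  | nil => exact one_mem _
  | cons i w ih => rw [act_cons]; exact mul_mem (move_mem i) ih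

theorem exists_word {g : treeAut} (hg : g ∈ hanoiGroup) : ∃ w, act w = g := by
  induction hg using Subgroup.closure_induction with
  | mem x hx =>
    rcases hx with rfl | rfl | rfl
    · exact ⟨[0], by simp [a]⟩
    · exact ⟨[1], by simp [b]⟩
    · exact ⟨[2], by simp [c]⟩
  | one => exact ⟨[], rfl⟩
  | mul x y _ _ hx hy =>
    obtain ⟨v, rfl⟩ := hx
    obtain ⟨w, rfl⟩ := hy
    exact ⟨v ++ w, act_append v w⟩
  | inv x _ hx =>
    obtain ⟨v, rfl⟩ := hx
    exact ⟨v.reverse, act_reverse v⟩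

/-- The permutation of the first level induced by a word. -/
def permW (w : List (Fin 3)) : Equiv.Perm (Fin 3) :=
  (w.map fun i => Equiv.swap (i + 1) (i + 2)).prod

@[simp] theorem permW_nil : permW [] = 1 := rfl

@[simp] theorem permW_cons (i : Fin 3) (w : List (Fin 3)) :
    permW (i :: w) = Equiv.swap (i + 1) (i + 2) * permW w := List.prod_cons

/-- The section of a word at a vertex of the first level. -/
def secW : List (Fin 3) → Fin 3 → List (Fin 3)
  | [], _ => []
  | i :: w, j => if permW w j = i then i :: secW w j else secW w j

theorem act_cons_apply (w : List (Fin 3)) (j : Fin 3) (u : Vertex) :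
    (act w).1 (j :: u) = permW w j :: (act (secW w j)).1 u := by
  induction w with
  | nil => rfl
  | cons i w ih =>
    rw [act_cons, treeAut_mul_apply, ih, move_cons, permW_cons, Equiv.Perm.mul_apply, secW]
    split_ifs <;> simp

/-- The numbers of occurrences modulo two of the letters in a word. -/
def cnt (w : List (Fin 3)) : Fin 3 → ZMod 2 := fun x => (w.count x : ZMod 2)

@[simp] theorem cnt_nil : cnt [] = 0 := by ext x; simp [cnt]

theorem cnt_append (v w : List (Fin 3)) : cnt (v ++ w) = cnt v + cnt w := by
  ext x; simp [cnt]

theorem cnt_cons (i : Fin 3) (w : List (Fin 3)) : cnt (i :: w) = Pi.single i 1 + cnt w := by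
  ext x
  simp only [cnt, List.count_cons, Pi.add_apply, Pi.single_apply]
  by_cases h : i = x
  · simp [h, add_comm]
  · simp [h, Ne.symm h]

theorem cnt_reverse (w : List (Fin 3)) : cnt w.reverse = cnt w := by
  ext x; simp [cnt]

/-- Each letter of a word passes to exactly one of the three sections, because `permW w` is a
bijection. -/
theorem sum_secW_length (w : List (Fin 3)) : ∑ j, (secW w j).length = w.length := by
  induction w with
  | nil => simp [secW]
  | cons i w ih =>
    have : ∀ j, (secW (i :: w) j).length = (if permW w j = i then 1 else 0) + (secW w j).length := by
      intro j; rw [secW]; split_ifs <;> simp [add_comm]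
    simp only [this, Finset.sum_add_distrib, ih, List.length_cons]
    rw [Fintype.sum_equiv (permW w) _ (fun j => if j = i then 1 else 0) (fun _ => rfl)]
    simp [add_comm]

theorem sum_cnt_secW (w : List (Fin 3)) : ∑ j, cnt (secW w j) = cnt w := by
  induction w with
  | nil => simp [secW]
  | cons i w ih =>
    have : ∀ j, cnt (secW (i :: w) j) =
        (if permW w j = i then Pi.single i 1 else 0) + cnt (secW w j) := by
      intro j; rw [secW]; split_ifs <;> simp [cnt_cons]
    simp only [this, Finset.sum_add_distrib, ih, cnt_cons]
    rw [Fintype.sum_equiv (permW w) _ (fun j => if j = i then Pi.single i 1 else 0) (fun _ => rfl)]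
    simp

theorem length_secW_le (w : List (Fin 3)) (j : Fin 3) : (secW w j).length ≤ w.length := by
  rw [← sum_secW_length w]
  exact Finset.single_le_sum (f := fun j => (secW w j).length) (fun _ _ => Nat.zero_le _)
    (Finset.mem_univ j)

theorem swap_self_index (i : Fin 3) : Equiv.swap (i + 1) (i + 2) i = i := by
  revert i; decide

/-- A letter enters the section at `j` only if it equals the current image of `j`, and then it fixes
that image. If every letter enters, the image never leaves `j`. -/
theorem eq_replicate_of_length_secW {w : List (Fin 3)} {j : Fin 3}
    (h : (secW w j).length = w.length) : permW w j = j ∧ w = List.replicate w.length j := by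
  induction w with
  | nil => exact ⟨rfl, rfl⟩
  | cons i w ih =>
    have hl := length_secW_le w j
    rw [secW] at h
    split_ifs at h with hi
    · simp only [List.length_cons, Nat.add_right_cancel_iff] at h
      obtain ⟨h1, h2⟩ := ih h
      have : j = i := h1.symm.trans hi
      subst this
      refine ⟨by rw [permW_cons, Equiv.Perm.mul_apply, h1, swap_self_index], ?_⟩
      rw [List.length_cons, List.replicate_succ, ← h2]
    · simp only [List.length_cons] at h
      omega

theorem move_ne_one (i : Fin 3) : move i ≠ 1 := by
  intro h
  have h1 : (move i).1 [i + 1] = [i + 1] := by rw [h]; rfl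
  rw [move_cons] at h1
  have h2 := (List.cons.inj h1).1
  clear h1 h
  revert h2 i
  decide

/-- A word representing the identity contains each letter an even number of times. -/
theorem cnt_eq_zero_of_act_eq_one {w : List (Fin 3)} (hw : act w = 1) : cnt w = 0 := by
  induction hn : w.length using Nat.strong_induction_on generalizing w with
  | _ n ih =>
    subst hn
    by_cases h : ∃ j, (secW w j).length = w.length
    · obtain ⟨j, hj⟩ := h
      -- The word is a power of one involution, and odd powers are nontrivial.
      have hr := (eq_replicate_of_length_secW hj).2
      rcases Nat.even_or_odd' w.length with ⟨k, hk | hk⟩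
      · rw [hr]
        ext x
        simp only [cnt, List.count_replicate, hk, Pi.zero_apply]
        split_ifs
        · push_cast
          rw [show (2 : ZMod 2) = 0 from rfl, zero_mul]
        · simp
      · exfalso
        rw [hr, act, List.map_replicate, List.prod_replicate, hk, pow_succ, pow_mul, pow_two,
          move_mul_self, one_pow, one_mul] at hw
        exact move_ne_one j hw
    · push Not at h
      -- All three sections are strictly shorter words for the identity, and their counts add up to
      -- that of `w`.
      rw [← sum_cnt_secW]
      refine Finset.sum_eq_zero fun j _ => ih _ (lt_of_le_of_ne (length_secW_le w j) (h j)) ?_ rfl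
      refine treeAut_ext fun v => ?_
      have := act_cons_apply w j v
      rw [hw] at this
      exact (List.cons.inj this).2.symm

theorem cnt_eq_of_act_eq {v w : List (Fin 3)} (h : act v = act w) : cnt v = cnt w := by
  have h1 : cnt (v ++ w.reverse) = 0 := cnt_eq_zero_of_act_eq_one (by
    rw [act_append, act_reverse, h, mul_inv_cancel])
  rw [cnt_append, cnt_reverse] at h1
  rw [eq_neg_of_add_eq_zero_left h1, CharTwo.neg_eq]

/-- The class of an element of the Hanoi towers group in the abelianization `(ℤ/2)³`. -/
noncomputable def cls (g : hanoiGroup) : Fin 3 → ZMod 2 := cnt (exists_word g.2).choose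

theorem cls_eq_cnt {g : hanoiGroup} {w : List (Fin 3)} (h : act w = g.1) : cls g = cnt w :=
  cnt_eq_of_act_eq ((exists_word g.2).choose_spec.trans h.symm)

theorem cls_mul (g h : hanoiGroup) : cls (g * h) = cls g + cls h := by
  obtain ⟨v, hv⟩ := exists_word g.2
  obtain ⟨w, hw⟩ := exists_word h.2
  rw [cls_eq_cnt hv, cls_eq_cnt hw, ← cnt_append]
  exact cls_eq_cnt (by rw [act_append, hv, hw]; rfl)

theorem cls_one : cls 1 = 0 := cls_eq_cnt (w := []) rfl

theorem cls_inv (g : hanoiGroup) : cls g⁻¹ = cls g := by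
  have h := cls_mul g⁻¹ g
  rw [inv_mul_cancel, cls_one] at h
  rw [eq_neg_of_add_eq_zero_left h.symm, CharTwo.neg_eq]

/-! ### Automorphisms acting on each of the three first-level subtrees -/

/-- The map acting on the subtree at `x` as `g x`. -/
def joinFun (g : Fin 3 → treeAut) : Vertex → Vertex
  | [] => []
  | x :: u => x :: (g x).1 u

theorem joinFun_adj (g : Fin 3 → treeAut) {u v : Vertex} (h : ternaryTree.Adj u v) :
    ternaryTree.Adj (joinFun g u) (joinFun g v) := by
  have key : ∀ (u : Vertex) (x : Fin 3), ∃ y, joinFun g (u ++ [x]) = joinFun g u ++ [y] := by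
    intro u x
    cases u with
    | nil => exact ⟨x, by simp [joinFun, (g x).2.1]⟩
    | cons z u =>
      obtain ⟨y, hy⟩ := treeAut_child (g z) u x
      exact ⟨y, by simp [joinFun, hy]⟩
  rcases h with ⟨x, rfl⟩ | ⟨x, rfl⟩
  · exact Or.inl (key u x)
  · exact Or.inr (key v x)

theorem joinFun_joinFun (g h : Fin 3 → treeAut) (v : Vertex) :
    joinFun g (joinFun h v) = joinFun (g * h) v := by
  cases v <;> rfl

theorem joinFun_one (v : Vertex) : joinFun 1 v = v := by
  cases v <;> rfl

/-- The automorphism `(g 0, g 1, g 2)`, which fixes the first level and acts on the subtree at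
`x` as `g x`. -/
def join : (Fin 3 → treeAut) →* treeAut where
  toFun g := ⟨⟨joinFun g, joinFun g⁻¹, fun v => by rw [joinFun_joinFun, inv_mul_cancel, joinFun_one],
      fun v => by rw [joinFun_joinFun, mul_inv_cancel, joinFun_one]⟩, rfl, fun u v =>
    ⟨fun h => by
      have := joinFun_adj g⁻¹ h
      simpa [joinFun_joinFun, joinFun_one] using this, joinFun_adj g⟩⟩
  map_one' := treeAut_ext joinFun_one
  map_mul' g h := treeAut_ext fun v => (joinFun_joinFun g h v).symm

theorem join_cons (g : Fin 3 → treeAut) (x : Fin 3) (u : Vertex) :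
    (join g).1 (x :: u) = x :: (g x).1 u := rfl

theorem join_injective : Function.Injective join := by
  intro g h H
  refine funext fun x => treeAut_ext fun v => ?_
  have := join_cons g x v
  rw [H, join_cons] at this
  exact (List.cons.inj this).2.symm

theorem join_secW {w : List (Fin 3)} (hw : permW w = 1) :
    join (fun j => act (secW w j)) = act w := by
  refine treeAut_ext fun v => ?_
  cases v with
  | nil => exact (act w).2.1.symm
  | cons j u => rw [join_cons, act_cons_apply, hw]; rfl

/-- The join of three elements of the Hanoi towers group. -/
def joinH : (Fin 3 → hanoiGroup) →* treeAut :=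
  join.comp (hanoiGroup.subtype.compLeft (Fin 3))

theorem joinH_apply (h : Fin 3 → hanoiGroup) : joinH h = join fun j => (h j).1 := rfl

theorem joinH_cons (g : Fin 3 → hanoiGroup) (x : Fin 3) (u : Vertex) :
    (joinH g).1 (x :: u) = x :: (g x).1.1 u := rfl

theorem joinH_injective : Function.Injective joinH := by
  intro g h H
  have := join_injective H
  exact funext fun j => Subtype.ext (congrFun this j)

theorem exists_word_of_fixes {g : treeAut} (hg : g ∈ hanoiGroup) (h : ∀ j, g.1 [j] = [j]) :
    ∃ w, permW w = 1 ∧ act w = g := by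
  obtain ⟨w, rfl⟩ := exists_word hg
  refine ⟨w, Equiv.ext fun j => ?_, rfl⟩
  have := h j
  rw [act_cons_apply] at this
  exact (List.cons.inj this).1

/-- An element of the Hanoi towers group fixing the first level has sections in the Hanoi towers
group. -/
theorem exists_joinH_eq {g : treeAut} (hg : g ∈ hanoiGroup) (h : ∀ j, g.1 [j] = [j]) :
    ∃ f, joinH f = g := by
  obtain ⟨w, hw, rfl⟩ := exists_word_of_fixes hg h
  exact ⟨fun j => ⟨act (secW w j), act_mem _⟩, join_secW hw⟩

theorem exists_word_of_joinH_mem {f : Fin 3 → hanoiGroup} (hf : joinH f ∈ hanoiGroup) :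
    ∃ w, permW w = 1 ∧ act w = joinH f ∧ ∀ j, act (secW w j) = (f j).1 := by
  obtain ⟨w, hw, e⟩ := exists_word_of_fixes hf fun j => by
    rw [joinH_cons, (f j).1.2.1]
  refine ⟨w, hw, e, ?_⟩
  rw [← join_secW hw, joinH_apply] at e
  exact congrFun (join_injective e)

theorem cls_joinH {f : Fin 3 → hanoiGroup} (hf : joinH f ∈ hanoiGroup) :
    cls ⟨joinH f, hf⟩ = ∑ j, cls (f j) := by
  obtain ⟨w, hw, e, hs⟩ := exists_word_of_joinH_mem hf
  rw [cls_eq_cnt (w := w) e, ← sum_cnt_secW]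
  exact Finset.sum_congr rfl fun j _ => (cls_eq_cnt (hs j)).symm

/-! ### The first-level sections modulo the commutator subgroup -/

/-- The condition on the classes of three elements of the Hanoi towers group under which their
join is in the Hanoi towers group. -/
def IsAdmissible (m : Fin 3 → Fin 3 → ZMod 2) : Prop :=
  (∀ j x y, m j x + m j y = m 0 x + m 0 y) ∧ ∑ j, ∑ x, m j x = 0

/-- The classes of the sections of an element inducing the permutation `p` on the first level, up
to matrices of the form `α j + β x`. -/
def tau (p : Equiv.Perm (Fin 3)) (j x : Fin 3) : ZMod 2 :=
  if p = 1 then 0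
  else if p 0 = 0 ∨ p 1 = 1 ∨ p 2 = 2 then (if p j = j ∧ x = j then 1 else 0)
  else (if j = 0 ∧ x = 0 then 1 else 0) + (if j = p 0 ∧ x = p (p 0) then 1 else 0)

/-- The mixed difference in `(j, 0)` and `(x, y)` kills the ambiguity `α j + β x`, so `tau` obeys
the recursion of section classes exactly at this level. -/
theorem tau_swap_mul (p : Equiv.Perm (Fin 3)) (i j x y : Fin 3) :
    (tau (Equiv.swap (i + 1) (i + 2) * p) j x + tau (Equiv.swap (i + 1) (i + 2) * p) j y) +
      (tau (Equiv.swap (i + 1) (i + 2) * p) 0 x + tau (Equiv.swap (i + 1) (i + 2) * p) 0 y) =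
    ((if p j = i then Pi.single (M := fun _ => ZMod 2) i 1 else 0 : Fin 3 → ZMod 2) x +
      (if p j = i then Pi.single (M := fun _ => ZMod 2) i 1 else 0 : Fin 3 → ZMod 2) y) +
    ((if p 0 = i then Pi.single (M := fun _ => ZMod 2) i 1 else 0 : Fin 3 → ZMod 2) x +
      (if p 0 = i then Pi.single (M := fun _ => ZMod 2) i 1 else 0 : Fin 3 → ZMod 2) y) +
    ((tau p j x + tau p j y) + (tau p 0 x + tau p 0 y)) := by
  revert p i j x y
  decide +kernel

theorem cnt_secW_cons (i : Fin 3) (w : List (Fin 3)) (j : Fin 3) :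
    cnt (secW (i :: w) j) = (if permW w j = i then Pi.single i 1 else 0) + cnt (secW w j) := by
  rw [secW]; split_ifs <;> simp [cnt_cons]

theorem cnt_secW_mixed (w : List (Fin 3)) (j x y : Fin 3) :
    (cnt (secW w j) x + cnt (secW w j) y) + (cnt (secW w 0) x + cnt (secW w 0) y) =
      (tau (permW w) j x + tau (permW w) j y) + (tau (permW w) 0 x + tau (permW w) 0 y) := by
  induction w with
  | nil => simp [secW, tau]
  | cons i w ih =>
    rw [permW_cons, tau_swap_mul, ← ih]
    simp only [cnt_secW_cons, Pi.add_apply]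
    ring

theorem sign_permW (w : List (Fin 3)) : Equiv.Perm.sign (permW w) = (-1) ^ w.length := by
  induction w with
  | nil => simp
  | cons i w ih =>
    have h : i + 1 ≠ i + 2 := by revert i; decide
    rw [permW_cons, map_mul, ih, Equiv.Perm.sign_swap h, List.length_cons, pow_succ']

theorem sum_cnt (w : List (Fin 3)) : ∑ x, cnt w x = w.length := by
  induction w with
  | nil => simp
  | cons i w ih =>
    simp only [cnt_cons, Pi.add_apply, Finset.sum_add_distrib, ih]
    simp [add_comm]

/-- Each generator acts on the first level as an odd permutation, so the word has even length. -/
theorem sum_cnt_eq_zero {w : List (Fin 3)} (hw : permW w = 1) : ∑ x, cnt w x = 0 := by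
  have h := sign_permW w
  rw [hw, map_one, eq_comm, neg_one_pow_eq_one_iff_even (by decide)] at h
  rw [sum_cnt, ZMod.natCast_eq_zero_iff_even]
  exact h

theorem isAdmissible_cnt_secW {w : List (Fin 3)} (hw : permW w = 1) :
    IsAdmissible fun j => cnt (secW w j) := by
  constructor
  · intro j x y
    have h := cnt_secW_mixed w j x y
    rw [hw] at h
    simp only [tau, if_true, add_zero] at h
    rw [eq_neg_of_add_eq_zero_left h, CharTwo.neg_eq]
  · rw [Finset.sum_comm, ← sum_cnt_eq_zero hw]
    refine Finset.sum_congr rfl fun x _ => ?_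
    rw [← sum_cnt_secW w, Finset.sum_apply]

theorem isAdmissible_of_joinH_mem {f : Fin 3 → hanoiGroup} (hf : joinH f ∈ hanoiGroup) :
    IsAdmissible fun j => cls (f j) := by
  obtain ⟨w, hw, _, hs⟩ := exists_word_of_joinH_mem hf
  have := isAdmissible_cnt_secW hw
  simpa only [← fun j => cls_eq_cnt (hs j)] using this

/-! ### The join of elements of the commutator subgroup -/

/-- The free reduction of a word in involutions. -/
def reduceW : List (Fin 3) → List (Fin 3)
  | [] => []
  | i :: w => match reduceW w with
    | [] => [i]
    | k :: t => if i = k then t else i :: k :: t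

theorem act_reduceW (w : List (Fin 3)) : act (reduceW w) = act w := by
  induction w with
  | nil => rfl
  | cons i w ih =>
    rw [reduceW, act_cons, ← ih]
    cases reduceW w with
    | nil => simp
    | cons k t =>
      dsimp only
      split_ifs with h
      · rw [h, act_cons, ← mul_assoc, move_mul_self, one_mul]
      · simp

/-- The element of the Hanoi towers group represented by a word in the generators. -/
def actH (w : List (Fin 3)) : hanoiGroup := ⟨act w, act_mem w⟩

theorem actH_nil : actH [] = 1 := rfl

theorem actH_cons (i : Fin 3) (w : List (Fin 3)) : actH (i :: w) = actH [i] * actH w :=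
  Subtype.ext (by simp [actH])

theorem actH_reduceW (w : List (Fin 3)) : actH (reduceW w) = actH w :=
  Subtype.ext (act_reduceW w)

theorem exists_actH (g : hanoiGroup) : ∃ w, actH w = g := by
  obtain ⟨w, hw⟩ := exists_word g.2
  exact ⟨w, Subtype.ext hw⟩

theorem cls_actH (w : List (Fin 3)) : cls (actH w) = cnt w := cls_eq_cnt rfl

theorem joinH_actH_secW {w : List (Fin 3)} (hw : permW w = 1) :
    joinH (fun j => actH (secW w j)) = act w := join_secW hw

/-- The elements `g` of the Hanoi towers group such that the automorphism acting as `g` on the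
subtree at `j` and trivially elsewhere is in the Hanoi towers group. -/
def subtreeGroup (j : Fin 3) : Subgroup hanoiGroup :=
  (hanoiGroup.comap (joinH.comp (MonoidHom.mulSingle (fun _ : Fin 3 => hanoiGroup) j)))

theorem mem_subtreeGroup {j : Fin 3} {g : hanoiGroup} :
    g ∈ subtreeGroup j ↔ joinH (Pi.mulSingle j g) ∈ hanoiGroup := Iff.rfl

theorem act_mul_joinH_mulSingle (w : List (Fin 3)) (j : Fin 3) (g : hanoiGroup) :
    act w * joinH (Pi.mulSingle j g) = joinH (Pi.mulSingle (permW w j)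
      (actH (secW w j) * g * (actH (secW w j))⁻¹)) * act w := by
  refine treeAut_ext fun v => ?_
  cases v with
  | nil => rw [(act w * _).2.1, (_ * act w).2.1]
  | cons x u =>
    rw [treeAut_mul_apply, treeAut_mul_apply, joinH_cons, act_cons_apply, act_cons_apply,
      joinH_cons]
    congr 1
    by_cases h : x = j
    · subst h
      simp [actH]
    · rw [Pi.mulSingle_eq_of_ne h, Pi.mulSingle_eq_of_ne (fun e => h ((permW w).injective e))]
      rfl

theorem conj_mem_subtreeGroup {j : Fin 3} {g : hanoiGroup} (hg : g ∈ subtreeGroup j)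
    (w : List (Fin 3)) :
    actH (secW w j) * g * (actH (secW w j))⁻¹ ∈ subtreeGroup (permW w j) := by
  rw [mem_subtreeGroup] at hg ⊢
  have h := act_mul_joinH_mulSingle w j g
  rw [← mul_inv_eq_iff_eq_mul.2 h]
  exact mul_mem (mul_mem (act_mem w) hg) (inv_mem (act_mem w))

theorem subtreeGroup_le (j k : Fin 3) : subtreeGroup j ≤ subtreeGroup k := by
  intro g hg
  by_cases h : j = k
  · rwa [← h]
  · have e : ∃ i, permW [i] j = k ∧ secW [i] j = [] := by
      revert h; clear hg; revert j k; decide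
    obtain ⟨i, h1, h2⟩ := e
    have := conj_mem_subtreeGroup hg [i]
    rw [h1, h2, actH_nil] at this
    simpa using this

instance subtreeGroup_normal (j : Fin 3) : (subtreeGroup j).Normal where
  conj_mem g hg h := by
    have key : ∀ (i : Fin 3) (g : hanoiGroup), g ∈ subtreeGroup j →
        actH [i] * g * (actH [i])⁻¹ ∈ subtreeGroup j := by
      intro i g hg
      -- Every generator is the section at `j` of a word fixing `j`. For `i ≠ j`, carry `j` to `i`
      -- by the third generator, apply `i`, and come back; for `i = j`, take `k = l = i`.
      have e : ∀ i j : Fin 3, ∃ k l, permW [k, l, k] j = j ∧ reduceW (secW [k, l, k] j) = [i] := by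
        decide
      obtain ⟨k, l, h1, h2⟩ := e i j
      have := conj_mem_subtreeGroup hg [k, l, k]
      rwa [h1, ← actH_reduceW, h2] at this
    obtain ⟨w, rfl⟩ := exists_actH h
    induction w with
    | nil => simpa [actH_nil] using hg
    | cons i w ih =>
      rw [actH_cons, mul_inv_rev, ← mul_assoc, mul_assoc _ _ g, mul_assoc _ (_ * g)]
      exact key i _ ih

theorem mem_subtreeGroup_of_word {j : Fin 3} {v : List (Fin 3)} (w : List (Fin 3))
    (h : permW w = 1) (h1 : ∀ k, reduceW (secW w k) = if k = j then v else []) :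
    actH v ∈ subtreeGroup j := by
  rw [mem_subtreeGroup]
  convert act_mem w
  rw [← joinH_actH_secW h]
  congr 1
  funext k
  rw [← actH_reduceW (secW w k), h1]
  by_cases hk : k = j
  · subst hk; simp
  · rw [Pi.mulSingle_eq_of_ne hk, if_neg hk, actH_nil]

theorem commutator_mem_subtreeGroup (j i k : Fin 3) : actH [i, k, i, k] ∈ subtreeGroup j := by
  have key : ∀ i k : Fin 3, i ≠ k → actH [i, k, i, k] ∈ subtreeGroup k := by
    intro i k hik
    -- With `l` the third letter, `l i l` and `k` induce the same transposition and fix `k`, with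
    -- sections `i` and `k` there. In their commutator the sections elsewhere cancel.
    have e : ∃ l, permW [l, i, l, k, l, i, l, k] = 1 ∧
        ∀ x, reduceW (secW [l, i, l, k, l, i, l, k] x) = if x = k then [i, k, i, k] else [] := by
      revert i k; decide
    obtain ⟨l, h, h1⟩ := e
    exact mem_subtreeGroup_of_word _ h h1
  by_cases hik : i = k
  · subst hik
    rw [← actH_reduceW, show reduceW [i, i, i, i] = [] by simp [reduceW], actH_nil]
    exact one_mem _
  · exact subtreeGroup_le k j (key i k hik)

/-- The quotient by `subtreeGroup j` is generated by three commuting involutions, so the image of a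
word depends only on the parities of its letters. -/
theorem mem_subtreeGroup_of_cls_eq_zero (j : Fin 3) {g : hanoiGroup} (hg : cls g = 0) :
    g ∈ subtreeGroup j := by
  let x : Fin 3 → hanoiGroup ⧸ subtreeGroup j := fun i => QuotientGroup.mk (actH [i])
  have hsq : ∀ i, x i * x i = 1 := by
    intro i
    rw [← QuotientGroup.mk_mul, ← actH_cons, ← actH_reduceW,
      show reduceW [i, i] = [] by simp [reduceW], actH_nil, QuotientGroup.mk_one]
  have hcomm : ∀ i k, Commute (x i) (x k) := by
    intro i k
    have h := (QuotientGroup.eq_one_iff _).2 (commutator_mem_subtreeGroup j i k)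
    rw [actH_cons, actH_cons k, actH_cons i, QuotientGroup.mk_mul, QuotientGroup.mk_mul,
      QuotientGroup.mk_mul] at h
    have h' : x i * (x k * (x i * x k)) = 1 := h
    have h2 : x i * x k * (x i * x k) = 1 := by rw [mul_assoc, h']
    have hinv : ∀ i, (x i)⁻¹ = x i := fun i => inv_eq_of_mul_eq_one_left (hsq i)
    rw [Commute, SemiconjBy, eq_inv_of_mul_eq_one_left h2, mul_inv_rev, hinv, hinv]
  have hpow : ∀ w : List (Fin 3), QuotientGroup.mk (s := subtreeGroup j) (actH w) =
      x 0 ^ w.count 0 * x 1 ^ w.count 1 * x 2 ^ w.count 2 := by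
    intro w
    induction w with
    | nil => simp [actH_nil]
    | cons i w ih =>
      rw [actH_cons, QuotientGroup.mk_mul, ih]
      change x i * _ = _
      fin_cases i
      · simp [pow_succ', mul_assoc]
      · simp [pow_succ', mul_assoc, ((hcomm 1 0).pow_right _).left_comm]
      · simp [pow_succ', mul_assoc, ((hcomm 2 0).pow_right _).left_comm,
          ((hcomm 2 1).pow_right _).left_comm]
  obtain ⟨w, rfl⟩ := exists_actH g
  rw [cls_actH] at hg
  rw [← QuotientGroup.eq_one_iff, hpow]
  have h1 : ∀ i, x i ^ w.count i = 1 := by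
    intro i
    have := congrFun hg i
    rw [Pi.zero_apply, cnt, ZMod.natCast_eq_zero_iff_even] at this
    obtain ⟨k, hk⟩ := this
    rw [hk, ← two_mul, pow_mul, pow_two, hsq, one_pow]
  rw [h1, h1, h1, one_mul, one_mul]

/-! ### Characterization of the joins in the Hanoi towers group -/

theorem joinH_mem_of_cls_eq_zero {f : Fin 3 → hanoiGroup} (hf : ∀ j, cls (f j) = 0) :
    joinH f ∈ hanoiGroup := by
  have e : f = Pi.mulSingle 0 (f 0) * Pi.mulSingle 1 (f 1) * Pi.mulSingle 2 (f 2) := by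
    funext j
    fin_cases j <;> simp
  rw [e, map_mul, map_mul]
  have := fun j => mem_subtreeGroup.1 (mem_subtreeGroup_of_cls_eq_zero j (hf j))
  exact mul_mem (mul_mem (this 0) (this 1)) (this 2)

/-- The matrices of classes of joins which belong to the Hanoi towers group. -/
def realizable : AddSubgroup (Fin 3 → Fin 3 → ZMod 2) where
  carrier := {m | ∃ f, joinH f ∈ hanoiGroup ∧ ∀ j, cls (f j) = m j}
  zero_mem' := ⟨1, by rw [map_one]; exact one_mem _, fun _ => cls_one⟩
  add_mem' := by
    rintro m n ⟨f, hf, hm⟩ ⟨g, hg, hn⟩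
    exact ⟨f * g, by rw [map_mul]; exact mul_mem hf hg, fun j => by
      rw [Pi.mul_apply, cls_mul, hm, hn]; rfl⟩
  neg_mem' := by
    rintro m ⟨f, hf, hm⟩
    exact ⟨f, hf, fun j => by rw [hm, Pi.neg_apply, CharTwo.neg_eq]⟩

theorem cnt_secW_mem_realizable {w : List (Fin 3)} (hw : permW w = 1) :
    (fun j => cnt (secW w j)) ∈ realizable :=
  ⟨fun j => actH (secW w j), by rw [joinH_actH_secW hw]; exact act_mem w, fun j => cls_actH _⟩

theorem zmod_smul_mem_realizable (c : ZMod 2) {m : Fin 3 → Fin 3 → ZMod 2} (hm : m ∈ realizable) :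
    c • m ∈ realizable := by
  have : ∀ c : ZMod 2, c = 0 ∨ c = 1 := by decide
  rcases this c with rfl | rfl
  · rw [zero_smul]; exact zero_mem _
  · rwa [one_smul]

theorem mem_realizable {m : Fin 3 → Fin 3 → ZMod 2} (hm : IsAdmissible m) : m ∈ realizable := by
  -- The matrices of these four words form a basis of the four-dimensional space of admissible
  -- matrices; the coefficients solve the resulting linear system.
  have key : m =
      (m 0 0 + (∑ x, m 0 x) + ∑ x, m 1 x) • (fun j => cnt (secW [0, 1, 0, 1, 0, 1] j)) +
      (m 0 2 + ∑ x, m 1 x) • (fun j => cnt (secW [1, 2, 1, 2, 1, 2] j)) +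
      (∑ x, m 0 x) • (fun j => cnt (secW [0, 2, 0, 1] j)) +
      (∑ x, m 1 x) • (fun j => cnt (secW [1, 2, 1, 0] j)) := by
    have h : ∀ m : Fin 3 → Fin 3 → ZMod 2, IsAdmissible m → m =
        (m 0 0 + (∑ x, m 0 x) + ∑ x, m 1 x) • (fun j => cnt (secW [0, 1, 0, 1, 0, 1] j)) +
        (m 0 2 + ∑ x, m 1 x) • (fun j => cnt (secW [1, 2, 1, 2, 1, 2] j)) +
        (∑ x, m 0 x) • (fun j => cnt (secW [0, 2, 0, 1] j)) +
        (∑ x, m 1 x) • (fun j => cnt (secW [1, 2, 1, 0] j)) := by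
      unfold IsAdmissible
      decide +kernel
    exact h m hm
  rw [key]
  refine add_mem (add_mem (add_mem ?_ ?_) ?_) ?_ <;>
  exact zmod_smul_mem_realizable _ (cnt_secW_mem_realizable (by decide))

/-- Two triples with the same classes differ by a triple of class zero, which always joins into `Γ`.
-/
theorem joinH_mem_iff {f : Fin 3 → hanoiGroup} :
    joinH f ∈ hanoiGroup ↔ IsAdmissible fun j => cls (f j) := by
  refine ⟨isAdmissible_of_joinH_mem, fun h => ?_⟩
  obtain ⟨g, hg, hc⟩ := mem_realizable h
  have : joinH (f * g⁻¹) ∈ hanoiGroup := joinH_mem_of_cls_eq_zero fun j => by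
    rw [Pi.mul_apply, cls_mul, Pi.inv_apply, cls_inv, hc, CharTwo.add_self_eq_zero]
  rw [← inv_mul_cancel_right f g, map_mul]
  exact mul_mem this hg

/-! ### Level stabilizers and rigid stabilizers of the Hanoi towers group -/

theorem mem_levelStab_succ {n : ℕ} {g : hanoiGroup} :
    g ∈ levelStab hanoiGroup (n + 1) ↔
      ∃ f, joinH f = g.1 ∧ ∀ j, f j ∈ levelStab hanoiGroup n := by
  constructor
  · intro hg
    have h1 : g ∈ levelStab hanoiGroup 1 := levelStab_antitone _ (by omega) hg
    rw [mem_levelStab] at hg h1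
    obtain ⟨f, hf⟩ := exists_joinH_eq g.2 fun j => h1 [j] rfl
    refine ⟨f, hf, fun j => ?_⟩
    rw [mem_levelStab]
    intro u hu
    have := hg (j :: u) (by simp [hu])
    rw [← hf, joinH_cons] at this
    exact (List.cons.inj this).2
  · rintro ⟨f, hf, h⟩
    rw [mem_levelStab]
    intro u hu
    cases u with
    | nil => exact g.1.2.1
    | cons j u =>
      rw [← hf, joinH_cons]
      have := h j
      rw [mem_levelStab] at this
      rw [this u (by simpa using hu)]

theorem mem_levelStab_one {g : hanoiGroup} :
    g ∈ levelStab hanoiGroup 1 ↔ ∃ f, joinH f = g.1 := by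
  rw [mem_levelStab_succ]
  refine ⟨fun ⟨f, hf, _⟩ => ⟨f, hf⟩, fun ⟨f, hf⟩ => ⟨f, hf, fun j => ?_⟩⟩
  rw [mem_levelStab]
  intro u hu
  rw [List.length_eq_zero_iff] at hu
  rw [hu]
  exact (f j).1.2.1

/-- The abelianization map of the Hanoi towers group. -/
noncomputable def clsHom : hanoiGroup →* Multiplicative (Fin 3 → ZMod 2) where
  toFun g := Multiplicative.ofAdd (cls g)
  map_one' := by rw [cls_one]; rfl
  map_mul' g h := by rw [cls_mul]; rfl

/-- The elements of the `n`-th level stabilizer all of whose sections at level `n` have trivial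
class in the abelianization. -/
noncomputable def trivialSections : ℕ → Subgroup hanoiGroup
  | 0 => clsHom.ker
  | n + 1 => ((Subgroup.pi Set.univ fun _ : Fin 3 => trivialSections n).map joinH).comap
      hanoiGroup.subtype

theorem mem_trivialSections_succ {n : ℕ} {g : hanoiGroup} :
    g ∈ trivialSections (n + 1) ↔ ∃ f, joinH f = g.1 ∧ ∀ j, f j ∈ trivialSections n := by
  simp only [trivialSections, Subgroup.mem_comap, Subgroup.mem_map, Subgroup.mem_pi,
    Set.mem_univ, true_imp_iff, Subgroup.subtype_apply]
  exact exists_congr fun _ => and_comm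

theorem joinH_mem {f : Fin 3 → hanoiGroup} {g : hanoiGroup} (h : joinH f = g.1) :
    joinH f ∈ hanoiGroup := h ▸ g.2

theorem isAdmissible_of_joinH_eq {f : Fin 3 → hanoiGroup} {g : hanoiGroup} (h : joinH f = g.1) :
    IsAdmissible fun j => cls (f j) := isAdmissible_of_joinH_mem (joinH_mem h)

theorem cls_eq_sum {f : Fin 3 → hanoiGroup} {g : hanoiGroup} (h : joinH f = g.1) :
    cls g = ∑ j, cls (f j) := by
  rw [← cls_joinH (joinH_mem h)]
  congr 1
  exact Subtype.ext h.symm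

theorem cls_eq_zero_of_mem_trivialSections {n : ℕ} {g : hanoiGroup} (hg : g ∈ trivialSections n) :
    cls g = 0 := by
  induction n generalizing g with
  | zero => exact hg
  | succ n ih =>
    obtain ⟨f, hf, h⟩ := mem_trivialSections_succ.1 hg
    rw [cls_eq_sum hf]
    exact Finset.sum_eq_zero fun j _ => ih (h j)

/-- Comparison with a zero row makes row `j` constant, and the total sum is then three times the
constant, that is, the constant itself. -/
theorem IsAdmissible.eq_zero {m : Fin 3 → Fin 3 → ZMod 2} (hm : IsAdmissible m) {j : Fin 3}
    (h : ∀ k, k ≠ j → m k = 0) : m = 0 := by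
  have key : ∀ m : Fin 3 → Fin 3 → ZMod 2, IsAdmissible m → ∀ j, (∀ k, k ≠ j → m k = 0) →
      m = 0 := by
    unfold IsAdmissible
    decide +kernel
  exact key m hm j h

/-- The level must be positive: at the root the rigid stabilizer is all of `Γ`. -/
theorem mem_trivialSections_of_mem_vertexRist {n : ℕ} {u : Vertex} (hu : u.length = n + 1)
    {g : hanoiGroup} (hg : g ∈ vertexRist hanoiGroup u) : g ∈ trivialSections (n + 1) := by
  induction n generalizing u g with
  | zero =>
    obtain ⟨j, rfl⟩ := List.length_eq_one_iff.1 hu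
    have h1 : g ∈ levelStab hanoiGroup 1 := levelRist_le_levelStab _ 1
      (le_iSup (fun u : {u : Vertex // u.length = 1} => vertexRist hanoiGroup u) ⟨[j], rfl⟩ hg)
    obtain ⟨f, hf⟩ := mem_levelStab_one.1 h1
    refine mem_trivialSections_succ.2 ⟨f, hf, fun k => ?_⟩
    have h2 : (fun j => cls (f j)) = 0 := by
      refine (isAdmissible_of_joinH_eq hf).eq_zero (j := j) fun k hk => ?_
      have : f k = 1 := by
        refine Subtype.ext (treeAut_ext fun v => ?_)
        have := hg (k :: v) fun hp => hk (List.cons_prefix_cons.1 hp).1.symm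
        rw [← hf, joinH_cons] at this
        exact (List.cons.inj this).2
      rw [this, cls_one]
    exact congrFun h2 k
  | succ n ih =>
    obtain ⟨j, v, rfl⟩ : ∃ j v, u = j :: v := by
      cases u with
      | nil => simp at hu
      | cons j v => exact ⟨j, v, rfl⟩
    have hv : v.length = n + 1 := by simpa using hu
    have h1 : g ∈ levelStab hanoiGroup 1 := levelStab_antitone _ (by omega)
      (levelRist_le_levelStab _ (n + 1 + 1)
        (le_iSup (fun u : {u : Vertex // u.length = n + 1 + 1} => vertexRist hanoiGroup u)
          ⟨j :: v, hu⟩ hg))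
    obtain ⟨f, hf⟩ := mem_levelStab_one.1 h1
    refine mem_trivialSections_succ.2 ⟨f, hf, fun k => ?_⟩
    have h3 : ∀ w, ¬ (j :: v) <+: (k :: w) → (f k).1.1 w = w := by
      intro w hw
      have := hg (k :: w) hw
      rw [← hf, joinH_cons] at this
      exact (List.cons.inj this).2
    by_cases hk : k = j
    · subst hk
      exact ih hv fun w hw => h3 w fun hp => hw (by simpa using hp)
    · have : f k = 1 := Subtype.ext (treeAut_ext fun w => h3 w fun hp =>
        hk (List.cons_prefix_cons.1 hp).1.symm)
      rw [this]
      exact one_mem _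

/-- The condition of class zero on the generators lets each of them be planted in a single subtree,
and it is inherited by the result, so the construction iterates. -/
theorem exists_joinH_mulSingle_mem_levelRist {n : ℕ} (j : Fin 3) {g : hanoiGroup}
    (hg : g ∈ Subgroup.closure
      {g | cls g = 0 ∧ ∃ u : Vertex, u.length = n ∧ g ∈ vertexRist hanoiGroup u}) :
    ∃ h ∈ Subgroup.closure
      {g | cls g = 0 ∧ ∃ u : Vertex, u.length = n + 1 ∧ g ∈ vertexRist hanoiGroup u},
      h.1 = joinH (Pi.mulSingle j g) := by
  induction hg using Subgroup.closure_induction with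
  | mem g hg =>
    obtain ⟨hc, u, hu, hr⟩ := hg
    have hm := mem_subtreeGroup.1 (mem_subtreeGroup_of_cls_eq_zero j hc)
    refine ⟨⟨_, hm⟩, Subgroup.subset_closure ⟨?_, j :: u, by simp [hu], ?_⟩, rfl⟩
    · rw [cls_joinH]
      refine Finset.sum_eq_zero fun k _ => ?_
      by_cases hk : k = j
      · subst hk; rwa [Pi.mulSingle_eq_same]
      · rw [Pi.mulSingle_eq_of_ne hk, cls_one]
    · intro v hv
      cases v with
      | nil => exact (joinH _).2.1
      | cons k v =>
        change (joinH (Pi.mulSingle j g)).1 (k :: v) = k :: v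
        rw [joinH_cons]
        by_cases hk : k = j
        · subst hk
          rw [Pi.mulSingle_eq_same, hr v fun hp => hv (List.cons_prefix_cons.2 ⟨rfl, hp⟩)]
        · rw [Pi.mulSingle_eq_of_ne hk]; rfl
  | one => exact ⟨1, one_mem _, by rw [Pi.mulSingle_one, map_one]; rfl⟩
  | mul x y _ _ hx hy =>
    obtain ⟨x', hx, ex⟩ := hx
    obtain ⟨y', hy, ey⟩ := hy
    exact ⟨x' * y', mul_mem hx hy, by rw [Pi.mulSingle_mul, map_mul, ← ex, ← ey]; rfl⟩
  | inv x _ hx =>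
    obtain ⟨x', hx, ex⟩ := hx
    exact ⟨x'⁻¹, inv_mem hx, by rw [Pi.mulSingle_inv, map_inv, ← ex]; rfl⟩

theorem mem_closure_of_mem_trivialSections {n : ℕ} {g : hanoiGroup}
    (hg : g ∈ trivialSections n) : g ∈ Subgroup.closure
      {g | cls g = 0 ∧ ∃ u : Vertex, u.length = n ∧ g ∈ vertexRist hanoiGroup u} := by
  induction n generalizing g with
  | zero => exact Subgroup.subset_closure ⟨hg, [], rfl, fun v hv => (hv (List.nil_prefix)).elim⟩
  | succ n ih =>
    obtain ⟨f, hf, h⟩ := mem_trivialSections_succ.1 hg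
    choose x hx ex using fun j => exists_joinH_mulSingle_mem_levelRist j (ih (h j))
    have e : g = x 0 * x 1 * x 2 := by
      refine Subtype.ext ?_
      rw [← hf]
      change _ = (x 0).1 * (x 1).1 * (x 2).1
      rw [ex, ex, ex, ← map_mul, ← map_mul]
      congr 1
      funext j
      fin_cases j <;> simp
    rw [e]
    exact mul_mem (mul_mem (hx 0) (hx 1)) (hx 2)

theorem levelRist_succ_eq (n : ℕ) : levelRist hanoiGroup (n + 1) = trivialSections (n + 1) := by
  apply le_antisymm
  · exact iSup_le fun u g hg => mem_trivialSections_of_mem_vertexRist u.2 hg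
  · intro g hg
    refine (Subgroup.closure_le _).2 ?_ (mem_closure_of_mem_trivialSections hg)
    rintro g ⟨_, u, hu, hr⟩
    exact le_iSup (fun u : {u : Vertex // u.length = n + 1} => vertexRist hanoiGroup u) ⟨u, hu⟩ hr

/-! ### Classes of the elements of the level stabilizers -/

theorem sum_cls_eq_zero {n : ℕ} (hn : 1 ≤ n) {g : hanoiGroup} (hg : g ∈ levelStab hanoiGroup n) :
    ∑ x, cls g x = 0 := by
  obtain ⟨f, hf⟩ := mem_levelStab_one.1 (levelStab_antitone _ hn hg)
  rw [cls_eq_sum hf, ← (isAdmissible_of_joinH_eq hf).2, Finset.sum_comm]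
  exact Finset.sum_congr rfl fun x _ => by rw [Finset.sum_apply]

/-- Rows of an admissible matrix differ by constant vectors, and a constant vector of length three
and sum zero vanishes. -/
theorem isAdmissible_iff_of_sum_eq_zero {m : Fin 3 → Fin 3 → ZMod 2} (h : ∀ j, ∑ x, m j x = 0) :
    IsAdmissible m ↔ m 0 = m 1 ∧ m 1 = m 2 := by
  have key : ∀ m : Fin 3 → Fin 3 → ZMod 2, (∀ j, ∑ x, m j x = 0) →
      (IsAdmissible m ↔ m 0 = m 1 ∧ m 1 = m 2) := by
    unfold IsAdmissible
    decide +kernel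
  exact key m h

/-- The three section classes coincide, and their sum is three times, hence once, the common value.
-/
theorem cls_section_eq {f : Fin 3 → hanoiGroup} {g : hanoiGroup} (hf : joinH f = g.1)
    (h : ∀ j, f j ∈ levelStab hanoiGroup 1) (j : Fin 3) : cls (f j) = cls g := by
  obtain ⟨h1, h2⟩ := (isAdmissible_iff_of_sum_eq_zero fun j => sum_cls_eq_zero le_rfl (h j)).1
    (isAdmissible_of_joinH_eq hf)
  rw [cls_eq_sum hf, Fin.sum_univ_three, h1, h2, CharTwo.add_self_eq_zero, zero_add]
  fin_cases j
  · exact h1.trans h2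
  · exact h2
  · rfl

/-- `cls_section_eq` propagates the class down the tree. One level is lost because it requires
sections in the first level stabilizer. -/
theorem mem_trivialSections_of_cls_eq_zero {n : ℕ} {g : hanoiGroup}
    (hg : g ∈ levelStab hanoiGroup (n + 1)) (h : cls g = 0) : g ∈ trivialSections n := by
  induction n generalizing g with
  | zero => exact h
  | succ n ih =>
    obtain ⟨f, hf, hs⟩ := mem_levelStab_succ.1 hg
    refine mem_trivialSections_succ.2 ⟨f, hf, fun j => ih (hs j) ?_⟩
    rw [cls_section_eq hf fun j => levelStab_antitone _ (by omega) (hs j), h]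

theorem exists_cls_eq (r : Fin 3 → ZMod 2) : ∃ g, cls g = r := by
  refine ⟨actH (List.replicate (r 0).val 0 ++ List.replicate (r 1).val 1 ++
    List.replicate (r 2).val 2), ?_⟩
  rw [cls_actH]
  funext x
  fin_cases x <;> simp [cnt, List.count_append, List.count_replicate]

/-- The diagonal triple `(g, g, g)` is admissible, has the class of `g`, and stabilizes one level
more. -/
theorem exists_mem_levelStab_cls_eq (n : ℕ) {r : Fin 3 → ZMod 2} (hr : ∑ x, r x = 0) :
    ∃ g ∈ levelStab hanoiGroup n, cls g = r := by
  induction n with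
  | zero =>
    obtain ⟨g, hg⟩ := exists_cls_eq r
    refine ⟨g, ?_, hg⟩
    rw [mem_levelStab]
    intro u hu
    rw [List.length_eq_zero_iff] at hu
    rw [hu]
    exact g.1.2.1
  | succ n ih =>
    obtain ⟨g, hg, hc⟩ := ih
    have hm : joinH (fun _ => g) ∈ hanoiGroup := by
      rw [joinH_mem_iff, isAdmissible_iff_of_sum_eq_zero fun _ => by rw [hc, hr]]
      exact ⟨rfl, rfl⟩
    refine ⟨⟨_, hm⟩, mem_levelStab_succ.2 ⟨_, rfl, fun _ => hg⟩, ?_⟩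
    rw [cls_joinH, Fin.sum_univ_three, hc, CharTwo.add_self_eq_zero, zero_add]

theorem cls_eq_zero_of_mem_levelRist {n : ℕ} (hn : 1 ≤ n) {g : hanoiGroup}
    (hg : g ∈ levelRist hanoiGroup n) : cls g = 0 := by
  obtain ⟨n, rfl⟩ := Nat.exists_eq_add_of_le' hn
  rw [levelRist_succ_eq] at hg
  exact cls_eq_zero_of_mem_trivialSections hg

/-- With `cls_eq_zero_of_mem_levelRist`, this identifies the kernel of a transition map with that of
the class map. -/
theorem mem_levelRist_of_cls_eq_zero {m n : ℕ} (hm : 1 ≤ m) (hmn : m < n) {g : hanoiGroup}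
    (hg : g ∈ levelStab hanoiGroup n) (h : cls g = 0) : g ∈ levelRist hanoiGroup m := by
  obtain ⟨m, rfl⟩ := Nat.exists_eq_add_of_le' hm
  rw [levelRist_succ_eq]
  exact mem_trivialSections_of_cls_eq_zero (levelStab_antitone _ hmn hg) h

/-! ### The quotients of the level stabilizers by the rigid ones -/

/-- The map to the abelianization of `Γ` induced on the quotient `Stab(n) ⧸ Rist(n)`. -/
noncomputable def quotientCls {n : ℕ} (hn : 1 ≤ n) :
    StabModRist hanoiGroup n →* Multiplicative (Fin 3 → ZMod 2) :=
  QuotientGroup.lift _ (clsHom.comp (levelStab hanoiGroup n).subtype)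
    fun _ hg => cls_eq_zero_of_mem_levelRist hn hg

theorem quotientCls_mk {n : ℕ} (hn : 1 ≤ n) (g : levelStab hanoiGroup n) :
    quotientCls hn (QuotientGroup.mk g) = Multiplicative.ofAdd (cls g.1) := rfl

/-- The Klein four-group of classes with an even sum. -/
def evenClasses : Subgroup (Multiplicative (Fin 3 → ZMod 2)) where
  carrier := {r | ∑ x, r.toAdd x = 0}
  one_mem' := Finset.sum_const_zero
  mul_mem' := fun {r s} hr hs => by
    change ∑ x, (r.toAdd x + s.toAdd x) = 0
    rw [Finset.sum_add_distrib, hr, hs, add_zero]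
  inv_mem' := fun {r} hr => by
    change ∑ x, -r.toAdd x = 0
    rw [Finset.sum_neg_distrib, hr, neg_zero]

theorem card_evenClasses : Nat.card evenClasses = 4 := by
  have e : evenClasses ≃ {r : Fin 3 → ZMod 2 // ∑ x, r x = 0} :=
    Equiv.subtypeEquiv Multiplicative.toAdd fun _ => Iff.rfl
  rw [Nat.card_congr e, Nat.card_eq_fintype_card]
  decide +kernel

theorem range_quotientCls {n : ℕ} (hn : 1 ≤ n) : (quotientCls hn).range = evenClasses := by
  ext r
  constructor
  · rintro ⟨x, rfl⟩
    obtain ⟨g, rfl⟩ := QuotientGroup.mk_surjective x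
    exact sum_cls_eq_zero hn g.2
  · intro hr
    obtain ⟨g, hg, hc⟩ := exists_mem_levelStab_cls_eq n hr
    exact ⟨QuotientGroup.mk ⟨g, hg⟩, by rw [quotientCls_mk, hc]; rfl⟩

theorem transition_mk {m n : ℕ} (h : m ≤ n) (g : levelStab hanoiGroup n) :
    transition hanoiGroup h (QuotientGroup.mk g) =
      QuotientGroup.mk ⟨g.1, levelStab_antitone hanoiGroup h g.2⟩ := rfl

theorem quotientCls_transition {m n : ℕ} (hm : 1 ≤ m) (h : m ≤ n) (x : StabModRist hanoiGroup n) :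
    quotientCls hm (transition hanoiGroup h x) = quotientCls (hm.trans h) x := by
  obtain ⟨g, rfl⟩ := QuotientGroup.mk_surjective x
  rfl

theorem transition_eq_one {m n : ℕ} (hm : 1 ≤ m) (h : m < n) {x : StabModRist hanoiGroup n}
    (hx : quotientCls (hm.trans h.le) x = 1) : transition hanoiGroup h.le x = 1 := by
  obtain ⟨g, rfl⟩ := QuotientGroup.mk_surjective x
  rw [transition_mk, QuotientGroup.eq_one_iff]
  exact mem_levelRist_of_cls_eq_zero hm h g.2 hx

theorem eq_of_mem_range_transition {m n : ℕ} (hm : 1 ≤ m) (h : m < n)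
    {x y : StabModRist hanoiGroup m} (hx : x ∈ (transition hanoiGroup h.le).range)
    (hy : y ∈ (transition hanoiGroup h.le).range) (hxy : quotientCls hm x = quotientCls hm y) :
    x = y := by
  obtain ⟨x, rfl⟩ := hx
  obtain ⟨y, rfl⟩ := hy
  rw [quotientCls_transition, quotientCls_transition] at hxy
  rw [← div_eq_one, ← map_div]
  exact transition_eq_one hm h (by rw [map_div, hxy, div_self'])

theorem map_range_transition {m n : ℕ} (hm : 1 ≤ m) (h : m ≤ n) :
    (transition hanoiGroup h).range.map (quotientCls hm) = evenClasses := by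
  rw [← MonoidHom.range_comp, ← range_quotientCls (hm.trans h)]
  congr 1
  exact MonoidHom.ext (quotientCls_transition hm h)

theorem range_transition_le {l m n : ℕ} (h : l ≤ m) (h' : m ≤ n) :
    (transition hanoiGroup (h.trans h')).range ≤ (transition hanoiGroup h).range := by
  rintro _ ⟨x, rfl⟩
  refine ⟨transition hanoiGroup h' x, ?_⟩
  obtain ⟨g, rfl⟩ := QuotientGroup.mk_surjective x
  rfl

theorem card_range_transition {m n : ℕ} (hm : 1 ≤ m) (h : m < n) :
    Nat.card (transition hanoiGroup h.le).range = 4 := by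
  rw [← card_evenClasses, ← map_range_transition hm h.le]
  refine Nat.card_congr (Equiv.Set.imageOfInjOn _ _ ?_)
  intro x hx y hy hxy
  exact eq_of_mem_range_transition hm h hx hy hxy

theorem range_transition_eq {m n : ℕ} (hm : 1 ≤ m) (h : m < n) :
    (transition hanoiGroup h.le).range = (transition hanoiGroup (Nat.le_add_right m 1)).range := by
  have hle := range_transition_le (Nat.le_add_right m 1) (Nat.succ_le_of_lt h)
  have hc := card_range_transition hm (Nat.lt_succ_self m)
  have : Finite (transition hanoiGroup (Nat.le_add_right m 1)).range :=
    Nat.finite_of_card_ne_zero (by rw [hc]; decide)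
  exact Subgroup.eq_of_le_of_card_ge hle (by rw [hc, card_range_transition hm h])

/-! ### The orders of the quotients -/

/-- The sections at the vertices of the first level. -/
noncomputable def sections (n : ℕ) :
    levelStab hanoiGroup (n + 1) →* (Fin 3 → levelStab hanoiGroup n) where
  toFun g j := ⟨(mem_levelStab_succ.1 g.2).choose j, (mem_levelStab_succ.1 g.2).choose_spec.2 j⟩
  map_one' := by
    have h := (mem_levelStab_succ.1 (1 : levelStab hanoiGroup (n + 1)).2).choose_spec.1
    have := joinH_injective (h.trans (map_one joinH).symm)
    exact funext fun j => Subtype.ext (congrFun this j)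
  map_mul' g g' := by
    have h := (mem_levelStab_succ.1 g.2).choose_spec.1
    have h' := (mem_levelStab_succ.1 g'.2).choose_spec.1
    have h'' := (mem_levelStab_succ.1 (g * g').2).choose_spec.1
    have := joinH_injective (h''.trans (((congrArg₂ (· * ·) h h').symm).trans
      (map_mul joinH _ _).symm))
    exact funext fun j => Subtype.ext (congrFun this j)

theorem joinH_sections {n : ℕ} (g : levelStab hanoiGroup (n + 1)) :
    joinH (fun j => (sections n g j).1) = g.1.1 := (mem_levelStab_succ.1 g.2).choose_spec.1

theorem exists_sections_eq {n : ℕ} (f : Fin 3 → levelStab hanoiGroup n)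
    (hf : IsAdmissible fun j => cls (f j).1) : ∃ g, sections n g = f := by
  have h := joinH_mem_iff.2 hf
  refine ⟨⟨⟨_, h⟩, mem_levelStab_succ.2 ⟨_, rfl, fun j => (f j).2⟩⟩, ?_⟩
  have := joinH_injective (joinH_sections
    ⟨⟨_, h⟩, mem_levelStab_succ.2 ⟨_, rfl, fun j => (f j).2⟩⟩)
  exact funext fun j => Subtype.ext (congrFun this j)

theorem mem_levelRist_succ_iff {n : ℕ} {g : levelStab hanoiGroup (n + 1)} :
    g.1 ∈ levelRist hanoiGroup (n + 1) ↔ ∀ j, (sections n g j).1 ∈ trivialSections n := by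
  rw [levelRist_succ_eq, mem_trivialSections_succ]
  refine ⟨fun ⟨f, hf, h⟩ j => ?_, fun h => ⟨_, joinH_sections g, h⟩⟩
  have := joinH_injective (hf.trans (joinH_sections g).symm)
  rw [← congrFun this j]
  exact h j

theorem card_stabModRist_one : Nat.card (StabModRist hanoiGroup 1) = 16 := by
  -- The matrix of section classes: its kernel is `Rist(1)` and its image is the set of admissible
  -- matrices.
  let φ : levelStab hanoiGroup 1 →* (Fin 3 → Multiplicative (Fin 3 → ZMod 2)) :=
    ((clsHom.comp (levelStab hanoiGroup 0).subtype).compLeft (Fin 3)).comp (sections 0)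
  have hk : (levelRist hanoiGroup 1).subgroupOf (levelStab hanoiGroup 1) = φ.ker := by
    ext g
    rw [Subgroup.mem_subgroupOf, mem_levelRist_succ_iff, MonoidHom.mem_ker, funext_iff]
    rfl
  rw [Nat.card_congr ((QuotientGroup.quotientMulEquivOfEq hk).trans
    (QuotientGroup.quotientKerEquivRange φ)).toEquiv]
  have e : φ.range ≃ {m : Fin 3 → Fin 3 → ZMod 2 // IsAdmissible m} := by
    refine Equiv.subtypeEquivRight fun m => ⟨?_, fun hm => ?_⟩
    · rintro ⟨g, rfl⟩
      exact isAdmissible_of_joinH_eq (joinH_sections g)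
    · obtain ⟨f, hf, hc⟩ := mem_realizable hm
      have h0 : ∀ g, g ∈ levelStab hanoiGroup 0 := fun g => by
        rw [mem_levelStab]
        intro u hu
        rw [List.length_eq_zero_iff.1 hu]
        exact g.1.2.1
      obtain ⟨g, hg⟩ := exists_sections_eq (fun j => ⟨f j, h0 _⟩) (joinH_mem_iff.1 hf)
      refine ⟨g, funext fun j => ?_⟩
      rw [← hc j]
      change clsHom (sections 0 g j).1 = _
      rw [hg]
      rfl
  have : DecidablePred IsAdmissible := fun m => by unfold IsAdmissible; infer_instance
  rw [Nat.card_congr e]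
  have e' : Nat.card {m : Fin 3 → Fin 3 → ZMod 2 //
      (∀ j x y, m j x + m j y = m 0 x + m 0 y) ∧ ∑ j, ∑ x, m j x = 0} = 16 := by
    rw [Nat.card_eq_fintype_card]
    decide +kernel
  exact e'

/-- The two quotients of consecutive coordinates which detect equality of the classes. -/
noncomputable def clsDiff {n : ℕ} (hn : 1 ≤ n) : (Fin 3 → StabModRist hanoiGroup n) →*
    Multiplicative (Fin 3 → ZMod 2) × Multiplicative (Fin 3 → ZMod 2) :=
  MonoidHom.prod
    ((quotientCls hn).comp (Pi.evalMonoidHom _ 0) / (quotientCls hn).comp (Pi.evalMonoidHom _ 1))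
    ((quotientCls hn).comp (Pi.evalMonoidHom _ 1) / (quotientCls hn).comp (Pi.evalMonoidHom _ 2))

theorem clsDiff_apply {n : ℕ} (hn : 1 ≤ n) (t : Fin 3 → StabModRist hanoiGroup n) :
    clsDiff hn t = (quotientCls hn (t 0) / quotientCls hn (t 1),
      quotientCls hn (t 1) / quotientCls hn (t 2)) := rfl

theorem range_clsDiff {n : ℕ} (hn : 1 ≤ n) :
    (clsDiff hn).range = evenClasses.prod evenClasses := by
  have hs : ∀ x, quotientCls hn x ∈ evenClasses := fun x => by
    rw [← range_quotientCls hn]; exact ⟨x, rfl⟩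
  ext ⟨r, s⟩
  rw [Subgroup.mem_prod]
  constructor
  · rintro ⟨t, ht⟩
    rw [clsDiff_apply, Prod.mk.injEq] at ht
    rw [← ht.1, ← ht.2]
    exact ⟨div_mem (hs _) (hs _), div_mem (hs _) (hs _)⟩
  · rintro ⟨hr, hs⟩
    rw [← range_quotientCls hn] at hr hs
    obtain ⟨x, rfl⟩ := hr
    obtain ⟨y, rfl⟩ := hs
    -- The consecutive quotients are `x / 1` and `1 / y⁻¹ = y`.
    exact ⟨![x, 1, y⁻¹], by simp [clsDiff_apply]⟩

/-- Sections embed the quotient at level `n + 1` in the cube of that at level `n`, as the triples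
with equal classes. This is the kernel of `clsDiff`, of index `4 * 4`. -/
theorem card_stabModRist_succ {n : ℕ} (hn : 1 ≤ n) :
    16 * Nat.card (StabModRist hanoiGroup (n + 1)) = Nat.card (StabModRist hanoiGroup n) ^ 3 := by
  let φ : levelStab hanoiGroup (n + 1) →* (Fin 3 → StabModRist hanoiGroup n) :=
    ((QuotientGroup.mk' _).compLeft (Fin 3)).comp (sections n)
  have hφ : ∀ g j, φ g j = QuotientGroup.mk (sections n g j) := fun _ _ => rfl
  have hk : (levelRist hanoiGroup (n + 1)).subgroupOf (levelStab hanoiGroup (n + 1)) = φ.ker := by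
    ext g
    rw [Subgroup.mem_subgroupOf, mem_levelRist_succ_iff, MonoidHom.mem_ker, funext_iff]
    refine forall_congr' fun j => ?_
    rw [hφ, Pi.one_apply, QuotientGroup.eq_one_iff, Subgroup.mem_subgroupOf]
    obtain ⟨n, rfl⟩ := Nat.exists_eq_add_of_le' hn
    rw [levelRist_succ_eq]
  have hr : φ.range = (clsDiff hn).ker := by
    ext t
    rw [MonoidHom.mem_ker, clsDiff_apply, Prod.mk_eq_one, div_eq_one, div_eq_one]
    constructor
    · rintro ⟨g, rfl⟩
      simp only [hφ, quotientCls_mk]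
      exact (isAdmissible_iff_of_sum_eq_zero fun j => sum_cls_eq_zero hn (sections n g j).2).1
        (isAdmissible_of_joinH_eq (joinH_sections g))
    · intro h
      choose f hf using fun j => QuotientGroup.mk_surjective (t j)
      simp only [← hf, quotientCls_mk] at h
      obtain ⟨g, hg⟩ := exists_sections_eq f
        ((isAdmissible_iff_of_sum_eq_zero fun j => sum_cls_eq_zero hn (f j).2).2 h)
      exact ⟨g, funext fun j => by rw [hφ, hg, hf]⟩
  rw [Nat.card_congr ((QuotientGroup.quotientMulEquivOfEq hk).trans
    (QuotientGroup.quotientKerEquivRange φ)).toEquiv, hr]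
  have h := Subgroup.card_eq_card_quotient_mul_card_subgroup (clsDiff hn).ker
  rw [Nat.card_congr (QuotientGroup.quotientKerEquivRange (clsDiff hn)).toEquiv, range_clsDiff,
    Nat.card_congr (evenClasses.prodEquiv evenClasses).toEquiv, Nat.card_prod, card_evenClasses,
    Nat.card_pi] at h
  simpa using h.symm

theorem card_stabModRist (n : ℕ) :
    Nat.card (StabModRist hanoiGroup (n + 1)) = 2 ^ (2 * (3 ^ n + 1)) := by
  induction n with
  | zero => exact card_stabModRist_one
  | succ n ih =>
    have h := card_stabModRist_succ (Nat.le_add_left 1 n)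
    rw [ih, ← pow_mul] at h
    refine Nat.eq_of_mul_eq_mul_left (show 0 < 16 by decide) (h.trans ?_)
    rw [show 16 = 2 ^ 4 from rfl, ← pow_add]
    congr 1
    ring

/-! ### The rigid kernel -/

theorem stabModRistToQuotient_injective (G : Subgroup treeAut) (n : ℕ) :
    Function.Injective (stabModRistToQuotient G n) := by
  rw [injective_iff_map_eq_one]
  intro x hx
  obtain ⟨g, rfl⟩ := QuotientGroup.mk_surjective x
  rw [QuotientGroup.eq_one_iff]
  exact (QuotientGroup.eq_one_iff (N := levelRist G n) g.1).1 hx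

theorem stabModRistLimitToBranch_injective (G : Subgroup treeAut) :
    Function.Injective (stabModRistLimitToBranch G) := by
  intro x y h
  refine Subtype.ext (funext fun n => stabModRistToQuotient_injective G n ?_)
  exact congrFun (congrArg Subtype.val h) n

theorem range_stabModRistLimitToBranch (G : Subgroup treeAut) :
    (stabModRistLimitToBranch G).range = rigidKernel G := by
  ext x
  constructor
  · rintro ⟨y, rfl⟩
    refine Subtype.ext (funext fun n => ?_)
    change ristToStab G n (stabModRistToQuotient G n (y.1 n)) = 1
    obtain ⟨g, hg⟩ := QuotientGroup.mk_surjective (y.1 n)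
    rw [← hg]
    exact (QuotientGroup.eq_one_iff (N := levelStab G n) g.1).2 g.2
  · intro hx
    have h : ∀ n : ℕ+, ∃ y, stabModRistToQuotient G n y = x.1 n := by
      intro n
      have h1 : ristToStab G n (x.1 n) = 1 := congrFun (congrArg Subtype.val hx) n
      obtain ⟨g, hg⟩ := QuotientGroup.mk_surjective (x.1 n)
      rw [← hg] at h1 ⊢
      exact ⟨QuotientGroup.mk ⟨g, (QuotientGroup.eq_one_iff (N := levelStab G n) g).1 h1⟩, rfl⟩
    choose y hy using h
    refine ⟨⟨y, fun m n hmn => stabModRistToQuotient_injective G m ?_⟩,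
      Subtype.ext (funext hy)⟩
    rw [hy, ← x.2 m n hmn, ← hy]
    obtain ⟨g, hg⟩ := QuotientGroup.mk_surjective (y n)
    rw [← hg]
    rfl

/-- The class of a coherent sequence. -/
noncomputable def limitCls : stabModRistLimit hanoiGroup →* Multiplicative (Fin 3 → ZMod 2) :=
  (quotientCls le_rfl).comp
    ((Pi.evalMonoidHom (fun n : ℕ+ => StabModRist hanoiGroup n) 1).comp
      (stabModRistLimit hanoiGroup).subtype)

theorem limitCls_apply (x : stabModRistLimit hanoiGroup) (n : ℕ+) :
    limitCls x = quotientCls (Nat.succ_le_of_lt n.pos) (x.1 n) :=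
  (congrArg (quotientCls le_rfl) (x.2 1 n one_le).symm).trans
    (quotientCls_transition le_rfl (Nat.succ_le_of_lt n.pos) (x.1 n))

/-- Each coordinate is the image of the next one, which also has trivial class and so dies under the
transition map. -/
theorem limitCls_injective : Function.Injective limitCls := by
  rw [injective_iff_map_eq_one]
  intro x hx
  refine Subtype.ext (funext fun n => ?_)
  have h : n < n + 1 := PNat.lt_add_right n 1
  rw [← x.2 n (n + 1) h.le]
  exact transition_eq_one (Nat.succ_le_of_lt n.pos) h ((limitCls_apply x (n + 1)).symm.trans hx)

theorem range_limitCls : limitCls.range = evenClasses := by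
  apply le_antisymm
  · rintro _ ⟨x, rfl⟩
    rw [← range_quotientCls le_rfl]
    exact ⟨_, rfl⟩
  · intro r hr
    choose g hg hc using fun n => exists_mem_levelStab_cls_eq n hr
    -- Representatives are taken one level deeper than needed: two elements of `Stab(m+1)` with
    -- equal classes agree modulo `Rist(m)`, which gives coherence.
    refine ⟨⟨fun n => QuotientGroup.mk ⟨g (n + 1), levelStab_antitone _ (Nat.le_succ _) (hg _)⟩,
      fun m n hmn => ?_⟩, ?_⟩
    · have h : (m : ℕ) ≤ n := hmn
      refine (transition_mk h _).trans (QuotientGroup.eq.2 ?_)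
      rw [Subgroup.mem_subgroupOf]
      refine mem_levelRist_of_cls_eq_zero (Nat.succ_le_of_lt m.pos) (Nat.lt_succ_self m)
        (mul_mem (inv_mem (levelStab_antitone _ (by omega) (hg (n + 1)))) (hg (m + 1))) ?_
      change cls ((g (n + 1))⁻¹ * g (m + 1)) = 0
      rw [cls_mul, cls_inv, hc, hc, CharTwo.add_self_eq_zero]
    · change Multiplicative.ofAdd (cls (g (1 + 1))) = r
      rw [hc]
      rfl

theorem isKleinFour_rigidKernel : IsKleinFour (rigidKernel hanoiGroup) := by
  have e : rigidKernel hanoiGroup ≃* evenClasses :=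
    ((MulEquiv.subgroupCongr (range_stabModRistLimitToBranch hanoiGroup).symm).trans
      (MonoidHom.ofInjective (stabModRistLimitToBranch_injective hanoiGroup)).symm).trans
      ((MonoidHom.ofInjective limitCls_injective).trans (MulEquiv.subgroupCongr range_limitCls))
  have hcard : Nat.card (rigidKernel hanoiGroup) = 4 := by
    rw [Nat.card_congr e.toEquiv, card_evenClasses]
  have : Nontrivial (rigidKernel hanoiGroup) := by
    have : Finite (rigidKernel hanoiGroup) := Nat.finite_of_card_ne_zero (by rw [hcard]; decide)
    rw [← Finite.one_lt_card_iff_nontrivial, hcard]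
    decide
  refine ⟨hcard, ?_⟩
  refine (Nat.prime_two.eq_one_or_self_of_dvd _ (Monoid.exponent_dvd_of_forall_pow_eq_one ?_)
    ).resolve_left fun h => ?_
  · intro x
    apply e.injective
    rw [map_pow, map_one]
    refine Subtype.ext ?_
    change Multiplicative.ofAdd (2 • (e x).1.toAdd) = 1
    rw [CharTwo.two_nsmul]
    rfl
  · rw [Monoid.exp_eq_one_iff] at h
    exact not_subsingleton _ h

end HanoiTowers

theorem mainTheorem1 :
    -- the rigid kernel of the Hanoi towers group is the Klein four-group
    IsKleinFour (HanoiTowers.rigidKernel HanoiTowers.hanoiGroup) ∧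
    -- it is the inverse limit of the quotients of the level stabilizers by the rigid ones
    Function.Injective (HanoiTowers.stabModRistLimitToBranch HanoiTowers.hanoiGroup) ∧
    (HanoiTowers.stabModRistLimitToBranch HanoiTowers.hanoiGroup).range =
      HanoiTowers.rigidKernel HanoiTowers.hanoiGroup ∧
    -- the orders of these quotients
    (∀ n : ℕ, 1 ≤ n →
      Nat.card (HanoiTowers.StabModRist HanoiTowers.hanoiGroup n) =
        2 ^ (2 * (3 ^ (n - 1) + 1))) ∧
    -- the images of the transition maps stabilise at once, at order 4
    (∀ n k : ℕ, 1 ≤ n → 1 ≤ k →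
      (HanoiTowers.transition HanoiTowers.hanoiGroup (Nat.le_add_right n k)).range =
        (HanoiTowers.transition HanoiTowers.hanoiGroup (Nat.le_add_right n 1)).range ∧
      Nat.card (HanoiTowers.transition HanoiTowers.hanoiGroup (Nat.le_add_right n k)).range
        = 4) := by
  refine ⟨HanoiTowers.isKleinFour_rigidKernel,
    HanoiTowers.stabModRistLimitToBranch_injective _,
    HanoiTowers.range_stabModRistLimitToBranch _, fun n hn => ?_, fun n k hn hk => ?_⟩
  · obtain ⟨n, rfl⟩ := Nat.exists_eq_add_of_le' hn
    exact HanoiTowers.card_stabModRist n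
  · have h : n < n + k := Nat.lt_add_of_pos_right hk
    exact ⟨HanoiTowers.range_transition_eq hn h, HanoiTowers.card_range_transition hn h⟩
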